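/- Let $k\ge 1$ be an integer. All graphs are finite, simple and loopless. The odd-girth of a graph is the smallest length of an odd cycle in it ($\infty$ if there is none). Let $\mathcal{SP}_{2k+1}$ be the class of $K_4$-minor-free graphs of odd-girth at least $2k+1$. Let $K(2k+1,k)$ be the Kneser graph, whose vertices are the $k$-subsets of a $(2k+1)$-set, two of them being adjacent if they are disjoint. The fractional chromatic number $\chi_f(G)$ of a graph $G$ is the minimum of $\sum_I w_I$ over all assignments of real weights $w_I\ge 0$ to the independent sets $I$ of $G$ such that $\sum_{I\ni v} w_I\ge 1$ for every vertex $v$ of $G$. Then: 1. The Kneser graph $K(2k+1,k)$ bounds $\mathcal{SP}_{2k+1}$, that is, every graph in $\mathcal{SP}_{2k+1}$ admits a homomorphism to $K(2k+1,k)$. 2. Every graph $G$ in $\mathcal{SP}_{2k+1}$ satisfies $\chi_f(G)\le 2+\frac1k$. 3. This bound is tight: the cycle $C_{2k+1}$ belongs to $\mathcal{SP}_{2k+1}$ and $\chi_f(C_{2k+1})=2+\frac1k$. -/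

import Mathlib

universe u v

namespace SimpleGraph

/-- `H` is a minor of `G`: there are pairwise disjoint vertex sets of `G` (the branch sets), one for
each vertex of `H`, each inducing a (nonempty) connected subgraph of `G`, such that `G` has an edge
between the branch sets of any two adjacent vertices of `H`. -/
def IsMinor {W : Type v} {V : Type u} (H : SimpleGraph W) (G : SimpleGraph V) : Prop :=
  ∃ B : W → Set V,
    (∀ i, (G.induce (B i)).Connected) ∧
    (∀ i j, i ≠ j → Disjoint (B i) (B j)) ∧
    (∀ i j, H.Adj i j → ∃ x ∈ B i, ∃ y ∈ B j, G.Adj x y)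

/-- The odd-girth: the smallest length of an odd cycle, and `⊤` if there is no odd cycle. -/
noncomputable def oddGirth {V : Type u} (G : SimpleGraph V) : ℕ∞ :=
  ⨅ a, ⨅ w : G.Walk a a, ⨅ _ : w.IsCycle ∧ Odd w.length, (w.length : ℕ∞)

/-- The class of finite `K₄`-minor-free graphs of odd-girth at least `n`. -/
structure SP (n : ℕ) {V : Type u} (G : SimpleGraph V) : Prop where
  finite : Finite V
  minorFree : ¬ IsMinor (⊤ : SimpleGraph (Fin 4)) G
  le_oddGirth : (n : ℕ∞) ≤ G.oddGirth

/-- `H` bounds the class `C` of graphs: every graph in `C` admits a homomorphism to `H`. -/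
def Bounds {W : Type v} (H : SimpleGraph W) (C : ∀ {V : Type u}, SimpleGraph V → Prop) : Prop :=
  ∀ (V : Type u) (G : SimpleGraph V), C G → Nonempty (G →g H)

/-- The Kneser graph `K(p, q)`: its vertices are the `q`-subsets of a `p`-set, adjacent when
disjoint. (The condition `S ≠ T` only matters for `q = 0`.) -/
def kneserGraph (p q : ℕ) : SimpleGraph {S : Finset (Fin p) // S.card = q} where
  Adj S T := S ≠ T ∧ Disjoint S.1 T.1
  symm := ⟨fun _ _ h => ⟨h.1.symm, h.2.symm⟩⟩
  loopless := ⟨fun _ h => h.1 rfl⟩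

open Classical in
/-- A fractional colouring: nonnegative real weights on the independent sets of `G` (and weight `0`
on the other sets of vertices) such that every vertex receives a total weight of at least `1`. -/
structure IsFractionalColoring {V : Type u} [Fintype V] (G : SimpleGraph V)
    (w : Finset V → ℝ) : Prop where
  nonneg : ∀ I, 0 ≤ w I
  eq_zero : ∀ I : Finset V, ¬ G.IsIndepSet (I : Set V) → w I = 0
  one_le : ∀ x : V, 1 ≤ ∑ I : Finset V with x ∈ I, w I

/-- The fractional chromatic number: the least total weight of a fractional colouring. -/
noncomputable def fractionalChromaticNumber {V : Type u} [Fintype V] (G : SimpleGraph V) : ℝ :=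
  sInf {t : ℝ | ∃ w : Finset V → ℝ, G.IsFractionalColoring w ∧ ∑ I, w I = t}

/-- The infimum defining the fractional chromatic number is over a nonempty set that is bounded
below. -/
theorem fractionalChromaticNumber_wellDefined {V : Type u} [Fintype V] (G : SimpleGraph V) :
    {t : ℝ | ∃ w : Finset V → ℝ, G.IsFractionalColoring w ∧ ∑ I, w I = t}.Nonempty ∧
    BddBelow {t : ℝ | ∃ w : Finset V → ℝ, G.IsFractionalColoring w ∧ ∑ I, w I = t} := by
  classical
  constructor
  · obtain ⟨w, hw⟩ : ∃ w : Finset V → ℝ,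
        ∀ I, w I = if G.IsIndepSet (I : Set V) then 1 else 0 := ⟨_, fun _ => rfl⟩
    have h0 : ∀ I, 0 ≤ w I := fun I => by
      rw [hw]
      split_ifs <;> norm_num
    refine ⟨_, w, ⟨h0, fun I hI => by rw [hw, if_neg hI], fun x => ?_⟩, rfl⟩
    have h1 : w {x} = 1 := by
      rw [hw, if_pos (by simp)]
    rw [← h1]
    exact Finset.single_le_sum (fun I _ => h0 I) (by simp)
  · refine ⟨0, ?_⟩
    rintro t ⟨w, hw, rfl⟩
    exact Finset.sum_nonneg fun I _ => hw.nonneg I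

end SimpleGraph

/-! In `K(2k+1, k)`, sets `S` and `T` are joined by a walk of length `2n` iff `|S \ T| ≤ n`, and by
one of length `2n+1` iff `|S \ T| ≥ k - n`. So a homomorphism `f` forces `|f x \ f y|` into the
interval `[k - halfOddDist, evenDist]`, which the odd-girth makes nonempty. Take as label the point
of this interval nearest to `⌈k/2⌉`. The labels satisfy the triangle and perimeter inequalities,
which suffice to extend two `k`-sets by a third with prescribed differences
(`exists_card_eq_card_sdiff_eq`).

A `K₄`-minor-free graph with an edge has a vertex of degree 1 or 2
(`exists_adj_of_not_isMinor_top_four`). Contract it into a neighbour, realize the labels by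
induction, and put it back by the extension lemma. Edges have label `k`, so their ends receive
disjoint sets.

The `2k+1` ground elements then give independent sets of weight `1/k`, whence the upper bound. For
`C_{2k+1}`, independent sets have at most `k` vertices, whence the lower bound. -/

namespace SimpleGraph

/-! ### Odd closed walks and the odd-girth -/

section OddGirth

variable {V : Type u} {G : SimpleGraph V}

/-- A walk has the same parity as the path obtained from it by shortcuts, unless it is at least as
long as some odd cycle. -/
theorem Walk.length_bypass_mod_two_or [DecidableEq V] {x y : V} (p : G.Walk x y) :
    p.bypass.length % 2 = p.length % 2 ∨ G.oddGirth ≤ (p.length : ℕ∞) := by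
  induction p with
  | nil => left; rfl
  | @cons a b c h p ih =>
    rcases ih with ih | ih
    · rw [Walk.bypass]
      split_ifs with hs
      · have hlen := congrArg Walk.length (p.bypass.take_spec hs)
        rw [Walk.length_append] at hlen
        set q := p.bypass.takeUntil a hs with hq
        have hqp : q.IsPath := p.bypass_isPath.takeUntil hs
        -- The shortcut removes the closed walk formed by `h` and `q`. It preserves parity when `q`
        -- is odd; otherwise this closed walk is an odd cycle, since an even `q` cannot be the edge
        -- `h` itself.
        by_cases hpar : q.length % 2 = 1
        · left
          simp only [Walk.length_cons]
          omega
        · right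
          have hq1 : q.length ≠ 1 := by omega
          have hcyc : (Walk.cons h q).IsCycle :=
            Walk.cons_isCycle_iff q h |>.2 ⟨hqp, fun he => hq1 (hqp.length_eq_one_of_mem_edges (Sym2.eq_swap ▸ he))⟩
          have hodd : Odd (Walk.cons h q).length := by
            rw [Walk.length_cons, Nat.odd_iff]
            omega
          have hle : (Walk.cons h q).length ≤ (Walk.cons h p).length := by
            have := p.length_bypass_le_length
            simp only [Walk.length_cons]
            omega
          refine le_trans ?_ (Nat.cast_le.2 hle)
          exact iInf_le_of_le a (iInf_le_of_le _ (iInf_le _ ⟨hcyc, hodd⟩))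
      · left
        simp only [Walk.length_cons]
        omega
    · right
      exact ih.trans (Nat.cast_le.2 (by simp))

theorem oddGirth_le_of_odd_closed_walk {x : V} (p : G.Walk x x) (hp : Odd p.length) :
    G.oddGirth ≤ (p.length : ℕ∞) := by
  classical
  refine p.length_bypass_mod_two_or.resolve_left fun h => ?_
  rw [Walk.length_eq_zero_iff.2 (Walk.isPath_iff_nil.1 p.bypass_isPath)] at h
  rw [Nat.odd_iff] at hp
  omega

end OddGirth

/-! ### Parity distances and the labels of pairs -/

section ParityDistance

variable {V : Type u} (G : SimpleGraph V) (k : ℕ)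

/-- Half the length of a shortest even walk from `x` to `y`, truncated at `k`. -/
noncomputable def evenDist (x y : V) : ℕ :=
  sInf {n | n = k ∨ ∃ p : G.Walk x y, p.length = 2 * n}

/-- Half the length (rounded down) of a shortest odd walk from `x` to `y`, truncated at `k`. -/
noncomputable def halfOddDist (x y : V) : ℕ :=
  sInf {n | n = k ∨ ∃ p : G.Walk x y, p.length = 2 * n + 1}

variable {G k}

theorem evenDist_spec (x y : V) :
    G.evenDist k x y = k ∨ ∃ p : G.Walk x y, p.length = 2 * G.evenDist k x y :=
  Nat.sInf_mem (s := {n | n = k ∨ ∃ p : G.Walk x y, p.length = 2 * n}) ⟨k, Or.inl rfl⟩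

theorem halfOddDist_spec (x y : V) :
    G.halfOddDist k x y = k ∨ ∃ p : G.Walk x y, p.length = 2 * G.halfOddDist k x y + 1 :=
  Nat.sInf_mem (s := {n | n = k ∨ ∃ p : G.Walk x y, p.length = 2 * n + 1}) ⟨k, Or.inl rfl⟩

theorem evenDist_le (x y : V) : G.evenDist k x y ≤ k := Nat.sInf_le (Or.inl rfl)

theorem halfOddDist_le (x y : V) : G.halfOddDist k x y ≤ k := Nat.sInf_le (Or.inl rfl)

theorem evenDist_le_of_walk {x y : V} {n : ℕ} (p : G.Walk x y) (hp : p.length = 2 * n) :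
    G.evenDist k x y ≤ n := Nat.sInf_le (Or.inr ⟨p, hp⟩)

theorem halfOddDist_le_of_walk {x y : V} {n : ℕ} (p : G.Walk x y) (hp : p.length = 2 * n + 1) :
    G.halfOddDist k x y ≤ n := Nat.sInf_le (Or.inr ⟨p, hp⟩)

theorem evenDist_comm (x y : V) : G.evenDist k x y = G.evenDist k y x := by
  have key : ∀ x y : V, G.evenDist k x y ≤ G.evenDist k y x := fun x y => by
    rcases evenDist_spec (G := G) (k := k) y x with h | ⟨p, h⟩
    · exact (evenDist_le x y).trans h.ge
    · exact evenDist_le_of_walk p.reverse (by simpa using h)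
  exact (key x y).antisymm (key y x)

theorem halfOddDist_comm (x y : V) : G.halfOddDist k x y = G.halfOddDist k y x := by
  have key : ∀ x y : V, G.halfOddDist k x y ≤ G.halfOddDist k y x := fun x y => by
    rcases halfOddDist_spec (G := G) (k := k) y x with h | ⟨p, h⟩
    · exact (halfOddDist_le x y).trans h.ge
    · exact halfOddDist_le_of_walk p.reverse (by simpa using h)
  exact (key x y).antisymm (key y x)

theorem evenDist_self (x : V) : G.evenDist k x x = 0 :=
  Nat.le_zero.1 (evenDist_le_of_walk Walk.nil rfl)

theorem halfOddDist_of_adj {x y : V} (h : G.Adj x y) : G.halfOddDist k x y = 0 :=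
  Nat.le_zero.1 (halfOddDist_le_of_walk h.toWalk rfl)

theorem evenDist_triangle (x y z : V) :
    G.evenDist k x z ≤ G.evenDist k x y + G.evenDist k y z := by
  have h := evenDist_le (G := G) (k := k) x z
  rcases evenDist_spec (G := G) (k := k) x y with h1 | ⟨p, h1⟩
  · omega
  rcases evenDist_spec (G := G) (k := k) y z with h2 | ⟨q, h2⟩
  · omega
  exact evenDist_le_of_walk (p.append q) (by rw [Walk.length_append]; omega)

theorem evenDist_le_halfOddDist_add (x y z : V) :
    G.evenDist k x z ≤ G.halfOddDist k x y + G.halfOddDist k y z + 1 := by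
  have h := evenDist_le (G := G) (k := k) x z
  rcases halfOddDist_spec (G := G) (k := k) x y with h1 | ⟨p, h1⟩
  · omega
  rcases halfOddDist_spec (G := G) (k := k) y z with h2 | ⟨q, h2⟩
  · omega
  exact evenDist_le_of_walk (p.append q) (by rw [Walk.length_append]; omega)

theorem halfOddDist_triangle (x y z : V) :
    G.halfOddDist k x z ≤ G.halfOddDist k x y + G.evenDist k y z := by
  have h := halfOddDist_le (G := G) (k := k) x z
  rcases halfOddDist_spec (G := G) (k := k) x y with h1 | ⟨p, h1⟩
  · omega
  rcases evenDist_spec (G := G) (k := k) y z with h2 | ⟨q, h2⟩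
  · omega
  exact halfOddDist_le_of_walk (p.append q) (by rw [Walk.length_append]; omega)

/-- An even and an odd walk with the same ends form an odd closed walk. This makes the interval of
admissible labels nonempty. -/
theorem le_evenDist_add_halfOddDist (hG : ((2 * k + 1 : ℕ) : ℕ∞) ≤ G.oddGirth) (x y : V) :
    k ≤ G.evenDist k x y + G.halfOddDist k x y := by
  rcases evenDist_spec (G := G) (k := k) x y with h1 | ⟨p, h1⟩
  · omega
  rcases halfOddDist_spec (G := G) (k := k) x y with h2 | ⟨q, h2⟩
  · omega
  have hlen : (p.append q.reverse).length = 2 * (G.evenDist k x y + G.halfOddDist k x y) + 1 := by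
    rw [Walk.length_append, Walk.length_reverse]
    omega
  have h := hG.trans (oddGirth_le_of_odd_closed_walk (p.append q.reverse) ⟨_, hlen⟩)
  rw [hlen, Nat.cast_le] at h
  omega

variable (G k)

/-- An integer close to `k / 2` among those that are compatible, as values of `|S \ T|` for
`k`-subsets `S` and `T` of a `(2k + 1)`-set, with the walks of `G` from `x` to `y`. -/
noncomputable def halfEvenLabel (x y : V) : ℕ :=
  max (k - G.halfOddDist k x y) (min (G.evenDist k x y) ((k + 1) / 2))

variable {G k}

theorem halfEvenLabel_comm (x y : V) : G.halfEvenLabel k x y = G.halfEvenLabel k y x := by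
  rw [halfEvenLabel, halfEvenLabel, evenDist_comm, halfOddDist_comm]

theorem halfEvenLabel_le (x y : V) : G.halfEvenLabel k x y ≤ k := by
  have := evenDist_le (G := G) (k := k) x y
  rw [halfEvenLabel]
  omega

theorem halfEvenLabel_self (hG : ((2 * k + 1 : ℕ) : ℕ∞) ≤ G.oddGirth) (x : V) :
    G.halfEvenLabel k x x = 0 := by
  have h1 := le_evenDist_add_halfOddDist hG x x
  have h2 := evenDist_self (G := G) (k := k) x
  rw [halfEvenLabel]
  omega

theorem halfEvenLabel_of_adj {x y : V} (h : G.Adj x y) : G.halfEvenLabel k x y = k := by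
  have h1 := halfOddDist_of_adj (k := k) h
  have h2 := evenDist_le (G := G) (k := k) x y
  rw [halfEvenLabel]
  omega

/-- Let `m = (k + 1) / 2`, so that `k ≤ 2m ≤ k + 1`. A label below `m` equals `evenDist`, one above
`m` equals `k - halfOddDist`. If both right-hand labels are at least `m`, they sum to at least `k`;
otherwise a triangle inequality for the parity distances applies. -/
theorem halfEvenLabel_triangle (hG : ((2 * k + 1 : ℕ) : ℕ∞) ≤ G.oddGirth) (x y z : V) :
    G.halfEvenLabel k x z ≤ G.halfEvenLabel k x y + G.halfEvenLabel k y z := by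
  have h1 := le_evenDist_add_halfOddDist hG x y
  have h2 := le_evenDist_add_halfOddDist hG y z
  have h3 := le_evenDist_add_halfOddDist hG x z
  have e1 := evenDist_triangle (G := G) (k := k) x y z
  have e2 := halfOddDist_triangle (G := G) (k := k) x z y
  have e3 := halfOddDist_triangle (G := G) (k := k) z x y
  have c1 := evenDist_comm (G := G) (k := k) z y
  have c2 := evenDist_comm (G := G) (k := k) y x
  have c3 := halfOddDist_comm (G := G) (k := k) z x
  have c4 := halfOddDist_comm (G := G) (k := k) z y
  have l1 := halfOddDist_le (G := G) (k := k) x z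
  simp only [halfEvenLabel]
  omega

/-- If at most one label exceeds `m = (k + 1) / 2`, use `k + 2m ≤ 2k + 1`. If two do, they are `k -
halfOddDist`, and joining the two odd walks bounds the third. -/
theorem halfEvenLabel_perimeter (hG : ((2 * k + 1 : ℕ) : ℕ∞) ≤ G.oddGirth) (x y z : V) :
    G.halfEvenLabel k x y + G.halfEvenLabel k y z + G.halfEvenLabel k x z ≤ 2 * k + 1 := by
  have h1 := le_evenDist_add_halfOddDist hG x y
  have h2 := le_evenDist_add_halfOddDist hG y z
  have h3 := le_evenDist_add_halfOddDist hG x z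
  have e1 := evenDist_le_halfOddDist_add (G := G) (k := k) x y z
  have e2 := evenDist_le_halfOddDist_add (G := G) (k := k) x z y
  have e3 := evenDist_le_halfOddDist_add (G := G) (k := k) y x z
  have c3 := halfOddDist_comm (G := G) (k := k) y x
  have c4 := halfOddDist_comm (G := G) (k := k) z y
  simp only [halfEvenLabel]
  omega

end ParityDistance

end SimpleGraph

/-! ### Extending two `k`-sets by a third -/

namespace SimpleGraph

/-- Two `k`-subsets of a `(2k + 1)`-set can be extended by a third one with prescribed
differences, provided that the prescribed values satisfy the triangle inequalities and the
perimeter inequality. -/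
theorem exists_card_eq_card_sdiff_eq {k : ℕ} {A B : Finset (Fin (2 * k + 1))} (hA : A.card = k)
    (hB : B.card = k) {j l : ℕ} (hj : j ≤ k) (hl : l ≤ k)
    (h1 : (A \ B).card ≤ j + l) (h2 : j ≤ (A \ B).card + l) (h3 : l ≤ (A \ B).card + j)
    (h4 : (A \ B).card + j + l ≤ 2 * k + 1) :
    ∃ C : Finset (Fin (2 * k + 1)), C.card = k ∧ (C \ A).card = j ∧ (C \ B).card = l := by
  have cAB : (A ∩ B).card + (A \ B).card = k := by
    rw [Finset.card_inter_add_card_sdiff, hA]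
  have cBA : (A ∩ B).card + (B \ A).card = k := by
    rw [Finset.inter_comm, Finset.card_inter_add_card_sdiff, hB]
  have cU : (A ∪ B).card = k + (B \ A).card := by
    have := Finset.card_sdiff_add_card B A
    rw [Finset.union_comm] at this
    omega
  have cC : (A ∪ B)ᶜ.card = 2 * k + 1 - (A ∪ B).card := by
    rw [Finset.card_compl, Fintype.card_fin]
  set i := (A \ B).card with hi
  -- Here `a, b, c, d` are the numbers of elements of `C` in `A ∩ B`, `A \ B`, `B \ A` and outside
  -- `A ∪ B`. The sizes of `C`, `C \ A`, `C \ B` determine `b, c, d` from `a`; the inequalities say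
  -- that each part fits. The least `a` allowed by the lower bounds works.
  obtain ⟨a, a1, a2, a3, a4, a5, a6, a7⟩ : ∃ a, k ≤ l + i + a ∧ k ≤ j + i + a ∧ k ≤ l + j + a ∧
      a + i ≤ k ∧ a + l ≤ k ∧ a + j ≤ k ∧ a + i + j + l ≤ 2 * k + 1 :=
    ⟨max (k - l - i) (max (k - j - i) (k - l - j)), by omega⟩
  obtain ⟨b, hb⟩ := Nat.exists_eq_add_of_le a6
  obtain ⟨c, hc⟩ := Nat.exists_eq_add_of_le a5
  obtain ⟨d, hd⟩ := Nat.exists_eq_add_of_le a3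
  obtain ⟨P, hP, cP⟩ := Finset.exists_subset_card_eq (s := A ∩ B) (n := a) (by omega)
  obtain ⟨Q, hQ, cQ⟩ := Finset.exists_subset_card_eq (s := A \ B) (n := b) (by omega)
  obtain ⟨R, hR, cR⟩ := Finset.exists_subset_card_eq (s := B \ A) (n := c) (by omega)
  obtain ⟨T, hT, cT⟩ := Finset.exists_subset_card_eq (s := (A ∪ B)ᶜ) (n := d) (by omega)
  have p : ∀ x ∈ P, x ∈ A ∧ x ∈ B := fun x hx => Finset.mem_inter.1 (hP hx)
  have q : ∀ x ∈ Q, x ∈ A ∧ x ∉ B := fun x hx => Finset.mem_sdiff.1 (hQ hx)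
  have r : ∀ x ∈ R, x ∈ B ∧ x ∉ A := fun x hx => Finset.mem_sdiff.1 (hR hx)
  have t : ∀ x ∈ T, x ∉ A ∧ x ∉ B := fun x hx => by simpa using hT hx
  have dPQ : Disjoint P Q := Finset.disjoint_left.2 fun x hx hy => (q x hy).2 (p x hx).2
  have dRT : Disjoint R T := Finset.disjoint_left.2 fun x hx hy => (t x hy).2 (r x hx).1
  have dQT : Disjoint Q T := Finset.disjoint_left.2 fun x hx hy => (t x hy).1 (q x hx).1
  have dPQR : Disjoint (P ∪ Q) (R ∪ T) := by
    refine Finset.disjoint_left.2 fun x hx hy => ?_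
    have hxA : x ∈ A := (Finset.mem_union.1 hx).elim (fun h => (p x h).1) fun h => (q x h).1
    exact (Finset.mem_union.1 hy).elim (fun h => (r x h).2 hxA) fun h => (t x h).1 hxA
  refine ⟨(P ∪ Q) ∪ (R ∪ T), ?_, ?_, ?_⟩
  · rw [Finset.card_union_of_disjoint dPQR, Finset.card_union_of_disjoint dPQ,
      Finset.card_union_of_disjoint dRT, cP, cQ, cR, cT]
    clear * - hb hc hd
    omega
  · have : (P ∪ Q ∪ (R ∪ T)) \ A = R ∪ T := by
      ext x
      simp only [Finset.mem_sdiff, Finset.mem_union]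
      clear * - p q r t
      grind
    rw [this, Finset.card_union_of_disjoint dRT, cR, cT]
    clear * - hb hc hd
    omega
  · have : (P ∪ Q ∪ (R ∪ T)) \ B = Q ∪ T := by
      ext x
      simp only [Finset.mem_sdiff, Finset.mem_union]
      clear * - p q r t
      grind
    rw [this, Finset.card_union_of_disjoint dQT, cQ, cT]
    clear * - hb hc hd
    omega

/-! ### Contraction of an edge on a fixed vertex type -/

section Contract

variable {V : Type u} [DecidableEq V] {G : SimpleGraph V} {v c : V}

/-- The contraction of the vertex `v` into the vertex `c`; `v` is kept as an isolated vertex. -/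
def contract (G : SimpleGraph V) (v c : V) : SimpleGraph V :=
  G.map (Function.update id v c)

theorem contract_adj_of_adj {x y : V} (h : G.Adj x y) (hx : x ≠ v) (hy : y ≠ v) :
    (G.contract v c).Adj x y :=
  ⟨h.ne, x, y, h, by simp [hx], by simp [hy]⟩

theorem contract_adj_of_adj_left {y : V} (h : G.Adj v y) (hy : y ≠ c) :
    (G.contract v c).Adj c y :=
  ⟨hy.symm, v, y, h, by simp, by simp [h.ne']⟩

theorem not_contract_adj (hvc : v ≠ c) (y : V) : ¬ (G.contract v c).Adj v y := by
  rintro ⟨-, x', y', -, hx, -⟩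
  by_cases h : x' = v
  · subst h
    simp at hx
    exact hvc hx.symm
  · simp [h] at hx

theorem support_contract_subset (hvc : G.Adj v c) :
    (G.contract v c).support ⊆ G.support \ {v} := by
  rintro x ⟨y, hxy⟩
  refine ⟨?_, fun h => ?_⟩
  · obtain ⟨-, x', y', h, hx, -⟩ := hxy
    by_cases hv : x' = v
    · subst hv
      simp at hx
      subst hx
      exact ⟨_, hvc.symm⟩
    · simp [hv] at hx
      subst hx
      exact ⟨_, h⟩
  · rw [Set.mem_singleton_iff] at h
    subst h
    exact not_contract_adj hvc.ne y hxy

theorem ncard_support_contract_lt [Finite V] (hvc : G.Adj v c) :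
    (G.contract v c).support.ncard < G.support.ncard :=
  Set.ncard_lt_ncard (lt_of_le_of_lt (support_contract_subset hvc)
    ⟨Set.sdiff_subset, fun h => (h (show v ∈ G.support from ⟨c, hvc⟩)).2 rfl⟩) (Set.toFinite _)

/-- Branch sets pull back along the contraction map, whose nonempty fibres are single vertices or
the edge `vc`, hence connected. `hH` excludes the branch set `{v}`, whose preimage is empty: an edge
leaving a branch set yields a point of the image. -/
theorem IsMinor.of_contract {W : Type v} {H : SimpleGraph W} (hH : ∀ i, ∃ j, H.Adj i j)
    (hvc : G.Adj v c) (h : H.IsMinor (G.contract v c)) : H.IsMinor G := by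
  obtain ⟨B, hconn, hdisj, hadj⟩ := h
  set φ : V → V := Function.update id v c with hφ
  have hfib : ∀ x y, φ x = φ y → x = y ∨ G.Adj x y := by
    intro x y h
    by_cases hx : x = v <;> by_cases hy : y = v
    · left; rw [hx, hy]
    · right; simp [hφ, hx, hy] at h; rw [hx, ← h]; exact hvc
    · right; simp [hφ, hx, hy] at h; rw [hy, h]; exact hvc.symm
    · left; simpa [hφ, hx, hy] using h
  have hmem : ∀ i x' x, φ x' = x → x ∈ B i → x' ∈ φ ⁻¹' B i := by
    rintro i x' _ rfl h
    exact h
  have hreach : ∀ i, ∀ x y : B i, ((G.contract v c).induce (B i)).Walk x y →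
      ∀ x' y' : φ ⁻¹' B i, φ x' = x → φ y' = y → (G.induce (φ ⁻¹' B i)).Reachable x' y' := by
    intro i x y p
    have base : ∀ x' y' : φ ⁻¹' B i, φ x' = φ y' → (G.induce (φ ⁻¹' B i)).Reachable x' y' := by
      intro x' y' h
      rcases hfib _ _ h with h | h
      · rw [Subtype.ext h]
      · exact Adj.reachable h
    induction p with
    | nil => exact fun x' y' hx hy => base x' y' (hx.trans hy.symm)
    | @cons x z y h p ih =>
      intro x' y' hx hy
      obtain ⟨-, x1, z1, hxz, hx1, hz1⟩ := (h : (G.contract v c).Adj x z)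
      have mx : x1 ∈ φ ⁻¹' B i := hmem i x1 x hx1 x.2
      have mz : z1 ∈ φ ⁻¹' B i := hmem i z1 z hz1 z.2
      have hadj : (G.induce (φ ⁻¹' B i)).Adj ⟨x1, mx⟩ ⟨z1, mz⟩ := hxz
      exact ((base x' ⟨x1, mx⟩ (hx.trans hx1.symm)).trans hadj.reachable).trans
        (ih ⟨z1, mz⟩ y' hz1 hy)
  refine ⟨fun i => φ ⁻¹' B i, fun i => ?_, fun i j hij => (hdisj i j hij).preimage φ,
    fun i j hij => ?_⟩
  · obtain ⟨j, hij⟩ := hH i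
    obtain ⟨x, hx, y, -, -, x', y', -, hx', -⟩ := hadj i j hij
    rw [connected_iff]
    refine ⟨fun a b => ?_, ⟨x', hmem i x' x hx' hx⟩⟩
    obtain ⟨p⟩ := (hconn i).preconnected ⟨φ a, a.2⟩ ⟨φ b, b.2⟩
    exact hreach i _ _ p a b rfl rfl
  · obtain ⟨x, hx, y, hy, -, x', y', h, hx', hy'⟩ := hadj i j hij
    exact ⟨x', hmem i x' x hx' hx, y', hmem j y' y hy' hy, h⟩

theorem IsMinor.top_four_of_contract (hvc : G.Adj v c)
    (h : (⊤ : SimpleGraph (Fin 4)).IsMinor (G.contract v c)) :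
    (⊤ : SimpleGraph (Fin 4)).IsMinor G :=
  h.of_contract (fun i => ⟨i + 1, by revert i; decide⟩) hvc

end Contract

theorem isMinor_top_four_of_adj {V : Type u} {G : SimpleGraph V} {a b c d : V} (hab : G.Adj a b)
    (hac : G.Adj a c) (had : G.Adj a d) (hbc : G.Adj b c) (hbd : G.Adj b d) (hcd : G.Adj c d) :
    (⊤ : SimpleGraph (Fin 4)).IsMinor G := by
  have key : ∀ i j : Fin 4, i ≠ j → G.Adj (![a, b, c, d] i) (![a, b, c, d] j) := by
    intro i j hij
    fin_cases i <;> fin_cases j <;> simp_all [G.adj_comm]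
  refine ⟨fun i => {![a, b, c, d] i}, fun i => ?_, fun i j hij => ?_, fun i j hij => ?_⟩
  · exact ⟨fun x y => by rw [Subsingleton.elim x y]⟩
  · simpa using (key i j hij).ne
  · exact ⟨_, rfl, _, rfl, key i j hij.ne⟩

end SimpleGraph

/-! ### Minimum degree three forces a `K₄`-minor -/

namespace SimpleGraph

variable {V : Type u} [Finite V]

theorem exists_adj_ne_ne_of_three_le {G : SimpleGraph V} {x : V}
    (hx : 3 ≤ (G.neighborSet x).ncard) (a b : V) : ∃ y, G.Adj x y ∧ y ≠ a ∧ y ≠ b := by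
  have h2 : ({a, b} : Set V).ncard < (G.neighborSet x).ncard :=
    by
    have := Set.ncard_insert_le a {b}
    rw [Set.ncard_singleton] at this
    omega
  obtain ⟨y, hy, hne⟩ := Set.exists_mem_notMem_of_ncard_lt_ncard h2
  exact ⟨y, hy, by simpa using hne⟩

/-- Turns one exceptional vertex, as left by a contraction, into the exceptional edge that the
induction below requires. -/
theorem exists_adj_forall_three_le {G : SimpleGraph V} {a x₀ : V}
    (hdeg : ∀ x ∈ G.support, x ≠ a → 3 ≤ (G.neighborSet x).ncard) (hx₀ : x₀ ∈ G.support)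
    (hne : x₀ ≠ a) :
    ∃ p q, G.Adj p q ∧ (∀ x ∈ G.support, x ≠ p → x ≠ q → 3 ≤ (G.neighborSet x).ncard) ∧
      ∃ x ∈ G.support, x ≠ p ∧ x ≠ q := by
  by_cases ha : a ∈ G.support
  · obtain ⟨b, hab⟩ := ha
    refine ⟨a, b, hab, fun x hx h _ => hdeg x hx h, ?_⟩
    by_cases hb : x₀ = b
    · subst hb
      obtain ⟨y, hy, hya, -⟩ := exists_adj_ne_ne_of_three_le (hdeg x₀ hx₀ hne) a a
      exact ⟨y, ⟨_, hy.symm⟩, hya, hy.ne'⟩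
    · exact ⟨x₀, hx₀, hne, hb⟩
  · obtain ⟨q, hq⟩ := id hx₀
    obtain ⟨y, hy, hyq, -⟩ := exists_adj_ne_ne_of_three_le (hdeg x₀ hx₀ hne) q q
    exact ⟨x₀, q, hq, fun x hx _ _ => hdeg x hx fun h => ha (h ▸ hx), y, ⟨_, hy.symm⟩, hy.ne', hyq⟩

/-- If all the vertices, except isolated ones and the ends of an edge `ab`, have degree at least
`3`, and there is such a vertex, then there is a `K₄`-minor. -/
theorem isMinor_top_four_of_forall_three_le {G : SimpleGraph V} {a b : V} (hab : G.Adj a b)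
    (hdeg : ∀ x ∈ G.support, x ≠ a → x ≠ b → 3 ≤ (G.neighborSet x).ncard)
    (hex : ∃ x ∈ G.support, x ≠ a ∧ x ≠ b) : (⊤ : SimpleGraph (Fin 4)).IsMinor G := by
  classical
  induction hn : G.support.ncard using Nat.strong_induction_on generalizing G a b with
  | _ n ih =>
  subst hn
  by_cases hz : ∃ z, G.Adj z a ∧ G.Adj z b ∧ (G.neighborSet z).ncard = 3
  · obtain ⟨z, hza, hzb, hz3⟩ := hz
    obtain ⟨c, hzc, hca, hcb⟩ := exists_adj_ne_ne_of_three_le hz3.ge a b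
    have hN : ∀ y, G.Adj z y → y = a ∨ y = b ∨ y = c := by
      have hsub : ({a, b, c} : Set V) ⊆ G.neighborSet z := by
        rintro y (rfl | rfl | rfl) <;> assumption
      have h3 : ({a, b, c} : Set V).ncard = 3 :=
        Set.ncard_eq_three.2 ⟨a, b, c, hab.ne, hca.symm, hcb.symm, rfl⟩
      have heq := Set.eq_of_subset_of_ncard_le hsub (by rw [hz3, h3])
      intro y hy
      have : y ∈ ({a, b, c} : Set V) := by
        rw [heq]
        exact hy
      simpa using this
    -- Unless `a, b, c, z` span a `K₄`, contract `z` into `c`: then `c` loses the neighbour `z` but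
    -- gains `a` or `b`, and the other vertices outside `{a, b}` keep their neighbours.
    by_cases hK : G.Adj c a ∧ G.Adj c b
    · exact isMinor_top_four_of_adj hza hzb hzc hab hK.1.symm hK.2.symm
    have hcz : c ∈ G.support := ⟨z, hzc.symm⟩
    refine IsMinor.top_four_of_contract hzc
      (ih _ (ncard_support_contract_lt hzc) (contract_adj_of_adj hab hza.ne' hzb.ne') ?_
        ⟨c, ⟨a, contract_adj_of_adj_left hza hca.symm⟩, hca, hcb⟩ rfl)
    intro x hx hxa hxb
    obtain ⟨hxG, hxz⟩ := support_contract_subset hzc hx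
    rw [Set.mem_singleton_iff] at hxz
    refine (hdeg x hxG hxa hxb).trans ?_
    by_cases hxc : x = c
    · subst hxc
      have hsub : ∀ y, G.Adj x y → y ≠ z → (G.contract z x).Adj x y := fun y hy hyz =>
        contract_adj_of_adj hy hxz hyz
      rw [not_and_or] at hK
      rcases hK with hK | hK
      · rw [← Set.ncard_exchange (s := G.neighborSet x) hK hzc.symm]
        refine Set.ncard_le_ncard ?_
        rintro y (rfl | ⟨hy, hyz⟩)
        · exact contract_adj_of_adj_left hza hxa.symm
        · exact hsub y hy hyz
      · rw [← Set.ncard_exchange (s := G.neighborSet x) hK hzc.symm]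
        refine Set.ncard_le_ncard ?_
        rintro y (rfl | ⟨hy, hyz⟩)
        · exact contract_adj_of_adj_left hzb hxb.symm
        · exact hsub y hy hyz
    · refine Set.ncard_le_ncard fun y (hy : G.Adj x y) => ?_
      refine contract_adj_of_adj hy hxz ?_
      rintro rfl
      rcases hN x hy.symm with h | h | h <;> contradiction
  -- Now contract `b` into `a`. Only common neighbours of `a` and `b` lose a degree, and those have
  -- degree at least 4.
  · have hdeg' : ∀ x ∈ G.support, x ≠ a → x ≠ b →
        3 ≤ ((G.contract b a).neighborSet x).ncard := by
      intro x hx hxa hxb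
      have h3 := hdeg x hx hxa hxb
      have hsub : ∀ y, G.Adj x y → y ≠ b → (G.contract b a).Adj x y := fun y hy hyb =>
        contract_adj_of_adj hy hxb hyb
      by_cases hb : G.Adj x b
      · by_cases ha : G.Adj x a
        · have h4 : (G.neighborSet x).ncard ≠ 3 := fun h => hz ⟨x, ha, hb, h⟩
          have h5 := Set.ncard_sdiff_singleton_add_one (s := G.neighborSet x) hb
          have h6 : (G.neighborSet x \ {b}).ncard ≤ ((G.contract b a).neighborSet x).ncard :=
            Set.ncard_le_ncard fun y hy => hsub y hy.1 hy.2
          omega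
        · rw [← Set.ncard_exchange (s := G.neighborSet x) ha hb] at h3
          refine h3.trans (Set.ncard_le_ncard ?_)
          rintro y (rfl | ⟨hy, hyb⟩)
          · exact (contract_adj_of_adj_left hb.symm hxa).symm
          · exact hsub y hy hyb
      · refine h3.trans (Set.ncard_le_ncard fun y (hy : G.Adj x y) => hsub y hy ?_)
        rintro rfl
        exact hb hy
    obtain ⟨x₀, hx₀, hx₀a, hx₀b⟩ := hex
    obtain ⟨y, hy, -⟩ := exists_adj_ne_ne_of_three_le (hdeg' x₀ hx₀ hx₀a hx₀b) a a
    obtain ⟨p, q, hpq, hd, he⟩ := exists_adj_forall_three_le (G := G.contract b a) (a := a)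
      (fun x hx hxa => by
        obtain ⟨hxG, hxb⟩ := support_contract_subset hab.symm hx
        exact hdeg' x hxG hxa hxb) ⟨y, hy⟩ hx₀a
    exact IsMinor.top_four_of_contract hab.symm
      (ih _ (ncard_support_contract_lt hab.symm) hpq hd he rfl)

/-- A `K₄`-minor-free graph with an edge has a vertex of degree `1` or `2`. -/
theorem exists_adj_of_not_isMinor_top_four {G : SimpleGraph V}
    (hG : ¬ (⊤ : SimpleGraph (Fin 4)).IsMinor G) (hE : G.support.Nonempty) :
    ∃ v a b, G.Adj v a ∧ G.Adj v b ∧ ∀ y, G.Adj v y → y = a ∨ y = b := by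
  by_contra! hcon
  refine hG ?_
  have hdeg : ∀ x ∈ G.support, 3 ≤ (G.neighborSet x).ncard := by
    rintro x ⟨a, ha⟩
    obtain ⟨b, hb, hba, -⟩ := hcon x a a ha ha
    obtain ⟨c, hc, hca, hcb⟩ := hcon x a b ha hb
    have h3 : ({a, b, c} : Set V).ncard = 3 :=
      Set.ncard_eq_three.2 ⟨a, b, c, hba.symm, hca.symm, hcb.symm, rfl⟩
    rw [← h3]
    refine Set.ncard_le_ncard ?_
    rintro y (rfl | rfl | rfl) <;> assumption
  obtain ⟨a, b, hab⟩ := hE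
  obtain ⟨y, hy, hyb, -⟩ := exists_adj_ne_ne_of_three_le (hdeg a ⟨b, hab⟩) b b
  exact isMinor_top_four_of_forall_three_le hab (fun x hx _ _ => hdeg x hx)
    ⟨y, ⟨a, hy.symm⟩, hy.ne', hyb⟩

/-- The vertices of a `K₄`-minor-free graph can be mapped to `k`-subsets of a `(2k + 1)`-set in
such a way that the differences along the edges have prescribed sizes, if these come from a
function satisfying the triangle and perimeter inequalities. -/
theorem exists_finset_labelling {k : ℕ} {t : V → V → ℕ} (hcomm : ∀ x y, t x y = t y x)
    (hself : ∀ x, t x x = 0) (hle : ∀ x y, t x y ≤ k)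
    (htri : ∀ x y z, t x z ≤ t x y + t y z)
    (hper : ∀ x y z, t x y + t y z + t x z ≤ 2 * k + 1) {G : SimpleGraph V}
    (hG : ¬ (⊤ : SimpleGraph (Fin 4)).IsMinor G) :
    ∃ f : V → Finset (Fin (2 * k + 1)), (∀ x, (f x).card = k) ∧
      ∀ x y, G.Adj x y → (f x \ f y).card = t x y := by
  classical
  induction hn : G.support.ncard using Nat.strong_induction_on generalizing G with
  | _ n ih =>
  subst hn
  rcases G.support.eq_empty_or_nonempty with hE | hE
  · obtain ⟨S, -, hS⟩ := Finset.exists_subset_card_eq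
      (s := (Finset.univ : Finset (Fin (2 * k + 1)))) (n := k) (by simp; omega)
    exact ⟨fun _ => S, fun _ => hS, fun x y h => absurd (show x ∈ G.support from ⟨y, h⟩)
      (by simp [hE])⟩
  obtain ⟨v, a, b, hva, hvb, hN⟩ := exists_adj_of_not_isMinor_top_four hG hE
  obtain ⟨f, hf, hft⟩ := ih _ (ncard_support_contract_lt hva)
    (fun h => hG (IsMinor.top_four_of_contract hva h)) rfl
  -- The contraction makes `a` and `b` adjacent, and `t` is defined on all pairs, so the induction
  -- already controls this difference; `b = a` when `v` has degree 1.
  have hab : (f a \ f b).card = t a b := by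
    by_cases h : b = a
    · subst h
      simp [hself]
    · exact hft a b (contract_adj_of_adj_left hvb h)
  obtain ⟨S, hS, hSa, hSb⟩ := exists_card_eq_card_sdiff_eq (hf a) (hf b) (hle v a) (hle v b)
    (by rw [hab, hcomm v a]; exact htri a v b)
    (by rw [hab, hcomm a b, add_comm]; exact htri v b a)
    (by rw [hab, add_comm]; exact htri v a b)
    (by rw [hab]; have := hper v a b; omega)
  have hcard : ∀ x, (Function.update f v S x).card = k := by
    intro x
    by_cases hx : x = v
    · subst hx; simpa using hS
    · simpa [hx] using hf x
  have hv : ∀ y, G.Adj v y → (S \ f y).card = t v y := by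
    intro y hy
    rcases hN y hy with rfl | rfl <;> assumption
  refine ⟨Function.update f v S, hcard, fun x y hxy => ?_⟩
  by_cases hx : x = v
  · subst hx
    rw [Function.update_self, Function.update_of_ne hxy.ne']
    exact hv y hxy
  by_cases hy : y = v
  · subst hy
    rw [Function.update_self, Function.update_of_ne hx, hcomm, ← hv x hxy.symm]
    exact Finset.card_sdiff_comm ((hf x).trans hS.symm)
  · rw [Function.update_of_ne hx, Function.update_of_ne hy]
    exact hft x y (contract_adj_of_adj hxy hx hy)

end SimpleGraph

theorem SimpleGraph.SP.nonempty_hom_kneserGraph {V : Type u} {G : SimpleGraph V} {k : ℕ}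
    (hk : 1 ≤ k) (hG : G.SP (2 * k + 1)) : Nonempty (G →g kneserGraph (2 * k + 1) k) := by
  have := hG.finite
  have hg := hG.le_oddGirth
  obtain ⟨f, hf, hft⟩ := exists_finset_labelling (t := G.halfEvenLabel k) halfEvenLabel_comm
    (halfEvenLabel_self hg) halfEvenLabel_le (halfEvenLabel_triangle hg)
    (halfEvenLabel_perimeter hg) hG.minorFree
  refine ⟨⟨fun x => ⟨f x, hf x⟩, fun {x y} hxy => ?_⟩⟩
  have hd : Disjoint (f x) (f y) := by
    have h1 := hft x y hxy
    rw [halfEvenLabel_of_adj hxy] at h1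
    exact Finset.sdiff_eq_self_iff_disjoint.1
      (Finset.eq_of_subset_of_card_le Finset.sdiff_subset ((hf x).trans h1.symm).le)
  refine ⟨fun h => ?_, hd⟩
  have h0 : f x = ∅ := Finset.disjoint_self_iff_empty _ |>.1 (by
    have h' : f x = f y := congrArg Subtype.val h
    rwa [← h'] at hd)
  have := hf x
  rw [h0, Finset.card_empty] at this
  omega

/-! ### Bounds on the fractional chromatic number -/

namespace SimpleGraph

theorem fractionalChromaticNumber_le_of_hom_kneserGraph {V : Type u} [Fintype V]
    {G : SimpleGraph V} {p q : ℕ} (hq : 1 ≤ q) (f : G →g kneserGraph p q) :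
    G.fractionalChromaticNumber ≤ p / q := by
  classical
  have hq' : (q : ℝ) ≠ 0 := by positivity
  -- Each ground element `c` gives weight `1/q` to the independent set of vertices whose image
  -- contains `c`; the sum over `c` accounts for coinciding sets.
  obtain ⟨w, hw⟩ : ∃ w : Finset V → ℝ, ∀ I, w I =
      ∑ c : Fin p, if Finset.univ.filter (fun v => c ∈ (f v).1) = I then (1 / q : ℝ) else 0 :=
    ⟨_, fun _ => rfl⟩
  refine csInf_le (fractionalChromaticNumber_wellDefined G).2 ⟨w, ⟨?_, ?_, ?_⟩, ?_⟩
  · intro I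
    rw [hw]
    exact Finset.sum_nonneg fun c _ => by split_ifs <;> positivity
  · intro I hI
    rw [hw]
    refine Finset.sum_eq_zero fun c _ => if_neg ?_
    rintro rfl
    refine hI fun x hx y hy _ hxy => ?_
    exact Finset.disjoint_left.1 (f.map_adj hxy).2 (by simpa using hx) (by simpa using hy)
  · intro x
    refine le_of_eq ?_
    simp only [hw]
    rw [Finset.sum_comm]
    simp only [Finset.sum_ite_eq, Finset.mem_filter, Finset.mem_univ, true_and]
    rw [← Finset.sum_filter, Finset.sum_const, Finset.filter_univ_mem, (f x).2, nsmul_eq_mul,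
      mul_one_div_cancel hq']
  · simp only [hw]
    rw [Finset.sum_comm]
    simp [div_eq_mul_inv]

/-- If the independent sets have at most `m` vertices, then the fractional chromatic number is at
least the number of vertices divided by `m`. -/
theorem card_div_le_fractionalChromaticNumber {V : Type u} [Fintype V] {G : SimpleGraph V} {m : ℕ}
    (hm : 1 ≤ m) (h : ∀ I : Finset V, G.IsIndepSet (I : Set V) → I.card ≤ m) :
    (Fintype.card V : ℝ) / m ≤ G.fractionalChromaticNumber := by
  classical
  refine le_csInf (fractionalChromaticNumber_wellDefined G).1 ?_
  rintro _ ⟨w, hw, rfl⟩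
  rw [div_le_iff₀ (by positivity)]
  have h1 : (Fintype.card V : ℝ) ≤ ∑ x : V, ∑ I : Finset V, if x ∈ I then w I else 0 := by
    rw [← nsmul_one, ← Finset.card_univ, ← Finset.sum_const]
    refine Finset.sum_le_sum fun x _ => ?_
    rw [← Finset.sum_filter]
    convert hw.one_le x
  refine h1.trans ?_
  rw [Finset.sum_comm, Finset.sum_mul]
  refine Finset.sum_le_sum fun I _ => ?_
  rw [← Finset.sum_filter, Finset.sum_const, Finset.filter_univ_mem, nsmul_eq_mul, mul_comm]
  by_cases hI : G.IsIndepSet (I : Set V)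
  · exact mul_le_mul_of_nonneg_left (Nat.cast_le.2 (h I hI)) (hw.nonneg I)
  · simp [hw.eq_zero I hI]

/-! ### Cycles: independence, odd-girth, minors -/

section Cycle

theorem card_le_of_isIndepSet_cycleGraph {n : ℕ} {I : Finset (Fin (n + 2))}
    (hI : (cycleGraph (n + 2)).IsIndepSet (I : Set (Fin (n + 2)))) : 2 * I.card ≤ n + 2 := by
  -- An independent set is disjoint from its rotation by one step.
  have hdisj : Disjoint I (I.map (Equiv.addRight (1 : Fin (n + 2))).toEmbedding) := by
    refine Finset.disjoint_left.2 fun x hx hx' => ?_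
    obtain ⟨y, hy, rfl⟩ := Finset.mem_map.1 hx'
    have hadj : (cycleGraph (n + 2)).Adj (y + 1) y := cycleGraph_adj.2 (Or.inl (by simp))
    exact hI hx hy hadj.ne hadj
  have h := Finset.card_le_univ (I.disjUnion _ hdisj)
  rw [Finset.card_disjUnion, Finset.card_map, Fintype.card_fin] at h
  omega

theorem cycleGraph_adj_intCast {n : ℕ} {u v : Fin n} (h : (cycleGraph n).Adj u v) :
    (n : ℤ) ∣ (v : ℤ) - u - 1 ∨ (n : ℤ) ∣ (v : ℤ) - u + 1 := by
  have hu := u.2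
  have hv := v.2
  rw [cycleGraph_adj', Fin.sub_def, Fin.sub_def] at h
  simp only at h
  have hcast : ((n - u : ℕ) : ℤ) = n - u := by omega
  have hcast' : ((n - v : ℕ) : ℤ) = n - v := by omega
  rcases h with h | h
  · right
    have h1 := Nat.div_add_mod (n - v + u) n
    rw [h] at h1
    refine ⟨1 - ((n - v + u) / n : ℕ), ?_⟩
    zify at h1
    rw [hcast'] at h1
    push_cast
    rw [hcast']
    linarith
  · left
    have h1 := Nat.div_add_mod (n - u + v) n
    rw [h] at h1
    refine ⟨((n - u + v) / n : ℕ) - 1, ?_⟩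
    zify at h1
    rw [hcast] at h1
    push_cast
    rw [hcast]
    linarith

/-- The total displacement along a walk of a cycle. -/
theorem exists_displacement_of_walk_cycleGraph {n : ℕ} {u v : Fin n}
    (p : (cycleGraph n).Walk u v) :
    ∃ s : ℤ, |s| ≤ p.length ∧ (2 : ℤ) ∣ s - p.length ∧ (n : ℤ) ∣ (v : ℤ) - u - s := by
  induction p with
  | nil => exact ⟨0, by simp⟩
  | @cons u x v h p ih =>
    obtain ⟨s, hs, ⟨c, hc⟩, ⟨d, hd⟩⟩ := ih
    rw [abs_le] at hs
    rw [Walk.length_cons, Nat.cast_succ]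
    rcases cycleGraph_adj_intCast h with ⟨e, he⟩ | ⟨e, he⟩
    · refine ⟨s + 1, abs_le.2 ⟨?_, ?_⟩, ⟨c, ?_⟩, ⟨d + e, ?_⟩⟩ <;> linarith
    · refine ⟨s - 1, abs_le.2 ⟨?_, ?_⟩, ⟨c - 1, ?_⟩, ⟨d + e, ?_⟩⟩ <;> linarith

/-- The displacement of an odd closed walk is odd, hence nonzero, and is a multiple of `n`. -/
theorem le_oddGirth_cycleGraph (n : ℕ) : (n : ℕ∞) ≤ (cycleGraph n).oddGirth := by
  refine le_iInf fun a => le_iInf fun p => le_iInf fun hp => Nat.cast_le.2 ?_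
  obtain ⟨s, hs, hpar, hd⟩ := exists_displacement_of_walk_cycleGraph p
  have hodd := hp.2
  rw [Nat.odd_iff] at hodd
  rw [sub_self, zero_sub, dvd_neg] at hd
  by_contra! hlt
  have h0 : s = 0 := Int.eq_zero_of_abs_lt_dvd hd (by omega)
  omega

/-- A connected set of vertices is mapped to an interval by a function that changes by at most `1`
along its edges. -/
theorem exists_mem_eq_of_connected {V : Type u} {G : SimpleGraph V} {B : Set V}
    (hB : (G.induce B).Connected) {g : V → ℕ}
    (hg : ∀ x ∈ B, ∀ y ∈ B, G.Adj x y → g y ≤ g x + 1) {x z : V} (hx : x ∈ B) (hz : z ∈ B)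
    {m : ℕ} (h1 : g x ≤ m) (h2 : m ≤ g z) : ∃ y ∈ B, g y = m := by
  obtain ⟨p⟩ := hB.preconnected ⟨x, hx⟩ ⟨z, hz⟩
  have key : ∀ x z : B, (G.induce B).Walk x z → g x ≤ m → m ≤ g z → ∃ y ∈ B, g y = m := by
    intro x z p
    induction p with
    | @nil x => exact fun h1 h2 => ⟨x, x.2, h1.antisymm h2⟩
    | @cons x y z h p ih =>
      intro h1 h2
      by_cases hm : g x = m
      · exact ⟨x, x.2, hm⟩
      · have := hg x x.2 y y.2 h
        exact ih (by omega) h2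
  exact key _ _ p h1 h2

/-- The images of `B` and `C` under `g` are disjoint intervals, so one lies entirely before the
other. -/
theorem lt_of_connected_of_disjoint {V : Type u} {G : SimpleGraph V} {B C : Set V}
    (hB : (G.induce B).Connected) (hC : (G.induce C).Connected) (hBC : Disjoint B C) {g : V → ℕ}
    (hinj : g.Injective) (hgB : ∀ x ∈ B, ∀ y ∈ B, G.Adj x y → g y ≤ g x + 1)
    (hgC : ∀ x ∈ C, ∀ y ∈ C, G.Adj x y → g y ≤ g x + 1) {b c x y : V} (hb : b ∈ B) (hc : c ∈ C)
    (hbc : g b < g c) (hx : x ∈ B) (hy : y ∈ C) : g x < g y := by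
  have hne : ∀ x ∈ B, ∀ y ∈ C, g x ≠ g y := fun x hx y hy h =>
    Set.disjoint_left.1 hBC hx (hinj h ▸ hy)
  by_contra! hyx
  by_cases hcx : g c ≤ g x
  · obtain ⟨d, hd, hdc⟩ := exists_mem_eq_of_connected hB hgB hb hx hbc.le hcx
    exact hne d hd c hc hdc
  · obtain ⟨d, hd, hdx⟩ := exists_mem_eq_of_connected hC hgC hy hc hyx (by omega)
    exact hne x hx d hd hdx.symm

theorem not_isMinor_top_four_cycleGraph (n : ℕ) :
    ¬ (⊤ : SimpleGraph (Fin 4)).IsMinor (cycleGraph n) := by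
  rintro ⟨B, hconn, hdisj, hadj⟩
  obtain ⟨c, hc⟩ := (hconn 0).nonempty
  -- Cutting the cycle at `c ∈ B 0` leaves a path numbered by `g`. The other three branch sets are
  -- intervals of it, and the middle one separates the outer two, which should be adjacent.
  set g : Fin n → ℕ := fun x => if c ≤ x then x - c else x + n - c with hgdef
  have hinj : g.Injective := by
    intro x y h
    have := x.2
    have := y.2
    have := c.2
    simp only [hgdef, Fin.le_def] at h
    ext
    split_ifs at h <;> omega
  have hg : ∀ x y, x ≠ c → y ≠ c → (cycleGraph n).Adj x y → g y ≤ g x + 1 := by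
    intro x y hx hy h
    have hx2 := x.2
    have hy2 := y.2
    have := c.2
    have hx' : (x : ℕ) ≠ c := fun h => hx (Fin.ext h)
    have hy' : (y : ℕ) ≠ c := fun h => hy (Fin.ext h)
    have hd : (y : ℤ) - x = 1 ∨ (y : ℤ) - x = -1 ∨ (y : ℤ) - x = n - 1 ∨ (y : ℤ) - x = 1 - n := by
      rcases cycleGraph_adj_intCast h with ⟨e, he⟩ | ⟨e, he⟩
      · have : e < 1 := by nlinarith
        have : -2 < e := by nlinarith
        obtain rfl | rfl : e = 0 ∨ e = -1 := by omega
        all_goals omega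
      · have : e < 2 := by nlinarith
        have : -1 < e := by nlinarith
        obtain rfl | rfl : e = 0 ∨ e = 1 := by omega
        all_goals omega
    simp only [hgdef, Fin.le_def]
    split_ifs <;> omega
  have hne : ∀ i ≠ 0, ∀ x ∈ B i, x ≠ c := fun i hi x hx h =>
    Set.disjoint_left.1 (hdisj i 0 hi) hx (h ▸ hc)
  have hgB : ∀ i ≠ 0, ∀ x ∈ B i, ∀ y ∈ B i, (cycleGraph n).Adj x y → g y ≤ g x + 1 :=
    fun i hi x hx y hy h => hg x y (hne i hi x hx) (hne i hi y hy) h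
  have hrep : ∀ i, ∃ r, r ∈ B i := fun i => (hconn i).nonempty.elim fun r => ⟨r, r.2⟩
  choose r hr using hrep
  have hlt : ∀ i j, i ≠ 0 → j ≠ 0 → i ≠ j → g (r i) < g (r j) →
      ∀ x ∈ B i, ∀ y ∈ B j, g x < g y := fun i j hi hj hij h x hx y hy =>
    lt_of_connected_of_disjoint (hconn i) (hconn j) (hdisj i j hij) hinj (hgB i hi) (hgB j hj)
      (hr i) (hr j) h hx hy
  have key : ∀ i j l, i ≠ 0 → j ≠ 0 → l ≠ 0 → i ≠ j → j ≠ l → i ≠ l →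
      g (r i) < g (r j) → g (r j) < g (r l) → False := by
    intro i j l hi hj hl hij hjl hil h1 h2
    obtain ⟨x, hx, z, hz, hxz⟩ := hadj i l hil
    have h3 := hlt i j hi hj hij h1 x hx (r j) (hr j)
    have h4 := hlt j l hj hl hjl h2 (r j) (hr j) z hz
    have h5 := hg x z (hne i hi x hx) (hne l hl z hz) hxz
    omega
  have hrne : ∀ i j, i ≠ j → g (r i) ≠ g (r j) := fun i j hij h =>
    Set.disjoint_left.1 (hdisj i j hij) (hr i) (hinj h ▸ hr j)
  rcases (hrne 1 2 (by decide)).lt_or_gt with h12 | h12 <;>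
  rcases (hrne 2 3 (by decide)).lt_or_gt with h23 | h23 <;>
  rcases (hrne 1 3 (by decide)).lt_or_gt with h13 | h13
  · exact key 1 2 3 (by decide) (by decide) (by decide) (by decide) (by decide) (by decide) h12 h23
  · omega
  · exact key 1 3 2 (by decide) (by decide) (by decide) (by decide) (by decide) (by decide) h13 h23
  · exact key 3 1 2 (by decide) (by decide) (by decide) (by decide) (by decide) (by decide) h13 h12
  · exact key 2 1 3 (by decide) (by decide) (by decide) (by decide) (by decide) (by decide) h12 h13
  · exact key 2 3 1 (by decide) (by decide) (by decide) (by decide) (by decide) (by decide) h23 h13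
  · omega
  · exact key 3 2 1 (by decide) (by decide) (by decide) (by decide) (by decide) (by decide) h23 h12

theorem SP_cycleGraph (n : ℕ) : (cycleGraph n).SP n :=
  ⟨inferInstance, not_isMinor_top_four_cycleGraph n, le_oddGirth_cycleGraph n⟩

end Cycle

theorem SP.fractionalChromaticNumber_le {V : Type u} [Fintype V] {G : SimpleGraph V} {k : ℕ}
    (hk : 1 ≤ k) (hG : G.SP (2 * k + 1)) : G.fractionalChromaticNumber ≤ 2 + 1 / (k : ℝ) := by
  obtain ⟨f⟩ := hG.nonempty_hom_kneserGraph hk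
  refine (fractionalChromaticNumber_le_of_hom_kneserGraph hk f).trans_eq ?_
  have : (k : ℝ) ≠ 0 := by positivity
  push_cast
  field_simp

theorem le_fractionalChromaticNumber_cycleGraph {k : ℕ} (hk : 1 ≤ k) :
    2 + 1 / (k : ℝ) ≤ (cycleGraph (2 * k + 1)).fractionalChromaticNumber := by
  obtain ⟨j, rfl⟩ := Nat.exists_eq_add_of_le' hk
  refine le_trans (le_of_eq ?_) (card_div_le_fractionalChromaticNumber hk fun I hI => ?_)
  · rw [Fintype.card_fin]
    push_cast
    field_simp
  · have := card_le_of_isIndepSet_cycleGraph (n := 2 * j + 1) hI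
    omega

end SimpleGraph

theorem mainTheorem3 (k : ℕ) (hk : 1 ≤ k) :
    (SimpleGraph.kneserGraph (2 * k + 1) k).Bounds
      (fun {V : Type u} (G : SimpleGraph V) => G.SP (2 * k + 1)) ∧
    (∀ (V : Type u) [Fintype V] (G : SimpleGraph V), G.SP (2 * k + 1) →
      G.fractionalChromaticNumber ≤ 2 + 1 / (k : ℝ)) ∧
    (SimpleGraph.cycleGraph (2 * k + 1)).SP (2 * k + 1) ∧
    (SimpleGraph.cycleGraph (2 * k + 1)).fractionalChromaticNumber = 2 + 1 / (k : ℝ) :=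
  ⟨fun _ _ hG => hG.nonempty_hom_kneserGraph hk, fun _ _ _ hG => hG.fractionalChromaticNumber_le hk,
    SimpleGraph.SP_cycleGraph _,
    ((SimpleGraph.SP_cycleGraph _).fractionalChromaticNumber_le hk).antisymm
      (SimpleGraph.le_fractionalChromaticNumber_cycleGraph hk)⟩
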